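/- Let $q\in\mathbb{C}$ with $0<|q|<1$. For $x\in\mathbb{C}$ and an integer $m\ge 0$ put $(x;q)_m=\prod_{i=0}^{m-1}(1-xq^i)$, $(x;q)_\infty=\prod_{i=0}^{\infty}(1-xq^i)$, and $(x_1,\dots,x_r;q)_m=(x_1;q)_m\cdots(x_r;q)_m$ for $0\le m\le\infty$. Put $${}_4\phi_3\!\left[{a_0,a_1,a_2,a_3\atop b_1,b_2,b_3};q,z\right]=\sum_{k\ge0}\frac{(a_0,a_1,a_2,a_3;q)_k}{(q,b_1,b_2,b_3;q)_k}z^k,$$ where the sum stops at $k=n$ if $a_0=q^{-n}$ with an integer $n\ge0$. Let $n\ge0$ be an integer and let $a,b,c,d,e,f$ be nonzero complex numbers with $\left|\dfrac{cde}{abq^{n+1}}\right|<1$. Define $$\rho'(a,b;c,d,e,f,n)=\frac1b\sum_{k=0}^{\infty}\Big(1-\frac{aq^{2k+1}}{b}\Big)\frac{(-1/b;q)_{k+1}}{(-qa;q)_k}\,\frac{(-qa/c,-qa/d,-qa/e,-qa/f,-q^{1+n}f/b;q)_k}{(-c/b,-d/b,-e/b,-f/b,-a/(fq^n);q)_{k+1}}\Big(\frac{cde}{abq^{n+1}}\Big)^k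 .$$ Assume that no denominator vanishes in the series for $\rho'(a,b;c,d,e,f,n)$, in the series for $\rho'(b,a;c,d,e,f,n)$ (obtained by interchanging $a$ and $b$), or in the terms $0\le k\le n$ of the ${}_4\phi_3$ below. Then both series converge absolutely and $$\rho'(a,b;c,d,e,f,n)-\rho'(b,a;c,d,e,f,n)$$ $$=\Big(\frac1b-\frac1a\Big)\frac{(q,qa/b,qb/a,c,d,e,cd/ab,ce/ab,de/ab;q)_\infty}{(-qa,-qb,-c/a,-c/b,-d/a,-d/b,-e/a,-e/b,cde/qab;q)_\infty}\cdot\frac{fq^n}{ab}\cdot\frac{(qf/e,ef/ab;q)_n}{(-f/a,-f/b;q)_{n+1}}$$ $$\times\;{}_4\phi_3\!\left[{q^{-n},\,q/e,\,qab/ce,\,qab/de\atop q^{1-n}ab/ef,\,qf/e,\,q^2ab/cde};q,q\right].$$ -/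

import Mathlib

noncomputable section

/-- The `q`-shifted factorial `(x;q)_n = ∏_{i=0}^{n-1} (1 - x q^i)` for `n ≥ 0`. -/
def qPoch (x q : ℂ) (n : ℕ) : ℂ := ∏ i ∈ Finset.range n, (1 - x * q ^ i)

/-- The infinite `q`-shifted factorial `(x;q)_∞ = ∏_{k=0}^∞ (1 - x q^k)`, used for `‖q‖ < 1`
(where the product converges absolutely). -/
def qPochInf (x q : ℂ) : ℂ := ∏' k : ℕ, (1 - x * q ^ k)

/-- Compact notation `(a, b, …, c; q)_n`. -/
def qPochList (l : List ℂ) (q : ℂ) (n : ℕ) : ℂ := (l.map fun x => qPoch x q n).prod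

/-- Compact notation `(a, b, …, c; q)_∞`. -/
def qPochInfList (l : List ℂ) (q : ℂ) : ℂ := (l.map fun x => qPochInf x q).prod

/-- The unilateral basic hypergeometric series with list `as = [a₀, …, a_r]` of numerator
parameters and list `bs = [b₁, …, b_s]` of denominator parameters:
`∑_k (a₀, …, a_r; q)_k / (q, b₁, …, b_s; q)_k * {(-1)^k q^(k choose 2)}^(s - r) * z^k`. -/
def basicHyp (as bs : List ℂ) (q z : ℂ) : ℂ :=
  ∑' k : ℕ, qPochList as q k / qPochList (q :: bs) q k *
    ((-1) ^ k * q ^ (k.choose 2)) ^ ((bs.length : ℤ) + 1 - (as.length : ℤ)) * z ^ k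

/-- The `k`-th term of the series that defines `ρ'(a,b;c,d,e,f,n)`. -/
def rhoTerm (q a b c d e f : ℂ) (n k : ℕ) : ℂ :=
  (1 - a * q ^ (2 * k + 1) / b) * (qPoch (-1 / b) q (k + 1) / qPoch (-q * a) q k) *
    (qPochList [-q * a / c, -q * a / d, -q * a / e, -q * a / f, -q ^ (1 + n) * f / b] q k /
      qPochList [-c / b, -d / b, -e / b, -f / b, -a / (f * q ^ n)] q (k + 1)) *
    (c * d * e / (a * b * q ^ (n + 1))) ^ k

/-- The function `ρ'(a,b;c,d,e,f,n)`. -/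
def rhoPrime (q a b c d e f : ℂ) (n : ℕ) : ℂ :=
  1 / b * ∑' k : ℕ, rhoTerm q a b c d e f n k

end

/-! The two series are the two halves of bilateral sums. Put the fourth parameter `h` of a
very-well-poised `₆ψ₆` equal to `a * b`; this produces the quotient of `-1/b` and `-q a` factorials.
The factors involving `f` form a surplus: since `-q^(1+n) f / b` and `-a / (f q^n)` differ from the
companions of `f` by `n` shifts, they collapse to a constant times a product of `n` quadratics,
`vwpShift` at `f q^i` (`qPoch_pair_eq_prod_shift`).

Each quadratic has the form `1 + x u + x² s`, where `u` depends on `k` but `s = q / (a b)` does not.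
Hence the product at the points `f q^i` expands in products at the points `e / q^(i+1)` with
coefficients independent of `k` and symmetric in `a, b` (`prod_quadratic_expansion`). Multiplying a
term by such a product merely replaces `e` by `e / q^j`. So the difference of the two series is a
finite combination of bilateral `₆ψ₆` series, each summed by Bailey's formula (`vwpDiff_eq`); the
ratios of the values to the one at `j = 0`, times the coefficients, are the terms of the `₄φ₃`.

Bailey's formula itself comes from a telescoping contiguous relation under `h ↦ h q`. The boundary
term is symmetric in `a, b`, so it cancels in the difference (`vwpDiff_contiguous`). Iteration sends
`h` to `0`; all four parameters are removed in this way, and the remaining constant is found by a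
specialisation that leaves a single term (`vwpDiff_zero`). All terms are normalised without
parameter-dependent denominators so that these limits and specialisations are legitimate. -/

noncomputable section

open Filter Topology

/-! ### Finite and infinite `q`-shifted factorials. -/

section QPochhammer

variable {q : ℂ}

theorem qPoch_zero (x q : ℂ) : qPoch x q 0 = 1 := by simp [qPoch]

theorem qPoch_succ (x q : ℂ) (n : ℕ) : qPoch x q (n + 1) = qPoch x q n * (1 - x * q ^ n) := by
  simp [qPoch, Finset.prod_range_succ]

theorem qPoch_add (x q : ℂ) (m n : ℕ) :
    qPoch x q (m + n) = qPoch x q m * qPoch (x * q ^ m) q n := by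
  simp only [qPoch, Finset.prod_range_add]
  congr 1
  exact Finset.prod_congr rfl fun i _ => by ring

theorem qPoch_succ' (x q : ℂ) (n : ℕ) : qPoch x q (n + 1) = (1 - x) * qPoch (x * q) q n := by
  rw [add_comm, qPoch_add]
  simp [qPoch]

theorem summable_norm_mul_pow (hq : ‖q‖ < 1) (x : ℂ) : Summable fun i : ℕ => ‖-(x * q ^ i)‖ := by
  simp only [norm_neg, norm_mul, norm_pow]
  exact (summable_geometric_of_lt_one (norm_nonneg _) hq).mul_left _

theorem multipliable_qPochInf (hq : ‖q‖ < 1) (x : ℂ) :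
    Multipliable fun i : ℕ => 1 - x * q ^ i := by
  simpa only [sub_eq_add_neg] using multipliable_one_add_of_summable (summable_norm_mul_pow hq x)

theorem tendsto_qPoch (hq : ‖q‖ < 1) (x : ℂ) :
    Tendsto (fun n => qPoch x q n) atTop (𝓝 (qPochInf x q)) :=
  (multipliable_qPochInf hq x).tendsto_prod_tprod_nat

theorem qPoch_mul_qPochInf (hq : ‖q‖ < 1) (x : ℂ) (n : ℕ) :
    qPoch x q n * qPochInf (x * q ^ n) q = qPochInf x q := by
  have h := tendsto_qPoch hq x
  have h2 := (tendsto_qPoch hq (x * q ^ n)).const_mul (qPoch x q n)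
  refine tendsto_nhds_unique h2 ?_
  have h3 := h.comp (tendsto_add_atTop_nat n)
  refine h3.congr fun m => ?_
  rw [Function.comp, ← qPoch_add, add_comm]

theorem qPochInf_eq_mul (hq : ‖q‖ < 1) (x : ℂ) :
    qPochInf x q = (1 - x) * qPochInf (x * q) q := by
  simpa [qPoch] using (qPoch_mul_qPochInf hq x 1).symm

theorem qPochInf_zero (q : ℂ) : qPochInf 0 q = 1 := by simp [qPochInf]

theorem qPochInf_one (hq : ‖q‖ < 1) : qPochInf 1 q = 0 := by
  rw [qPochInf_eq_mul hq]; simp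

theorem qPochInf_ne_zero (hq : ‖q‖ < 1) {x : ℂ} (hx : ∀ i : ℕ, 1 - x * q ^ i ≠ 0) :
    qPochInf x q ≠ 0 := by
  have := tprod_one_add_ne_zero_of_summable (f := fun i : ℕ => -(x * q ^ i))
    (fun i => by simpa only [sub_eq_add_neg] using hx i) (summable_norm_mul_pow hq x)
  simpa only [qPochInf, sub_eq_add_neg] using this

theorem qPochInf_ne_zero_of_qPoch (hq : ‖q‖ < 1) {x : ℂ} (hx : ∀ k : ℕ, qPoch x q k ≠ 0) :
    qPochInf x q ≠ 0 :=
  qPochInf_ne_zero hq fun i => right_ne_zero_of_mul (qPoch_succ x q i ▸ hx (i + 1))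

theorem one_sub_mul_pow_ne_zero (hq : ‖q‖ < 1) {x : ℂ} (hx : ‖x‖ < 1) (i : ℕ) :
    1 - x * q ^ i ≠ 0 := by
  intro h
  have h1 : ‖x * q ^ i‖ = 1 := by rw [← sub_eq_zero.1 h]; simp
  have h2 : ‖x * q ^ i‖ ≤ ‖x‖ := by
    rw [norm_mul, norm_pow]
    exact mul_le_of_le_one_right (norm_nonneg _) (pow_le_one₀ (norm_nonneg _) hq.le)
  linarith

theorem qPochInf_ne_zero_of_norm_lt_one (hq : ‖q‖ < 1) {x : ℂ} (hx : ‖x‖ < 1) :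
    qPochInf x q ≠ 0 :=
  qPochInf_ne_zero hq (one_sub_mul_pow_ne_zero hq hx)

theorem qPoch_self_ne_zero (hq : ‖q‖ < 1) (n : ℕ) : qPoch q q n ≠ 0 :=
  Finset.prod_ne_zero_iff.2 fun i _ => one_sub_mul_pow_ne_zero hq hq i

/-- A finite product of `1 + fᵢ` differs from `1` by at most `exp (∑ ‖fᵢ‖) - 1`; pass to the limit.
This gives both a bound uniform on discs and continuity at `0`, the two inputs of the dominated
convergence below. -/
theorem norm_qPochInf_sub_one_le (hq : ‖q‖ < 1) (x : ℂ) :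
    ‖qPochInf x q - 1‖ ≤ Real.exp (‖x‖ / (1 - ‖q‖)) - 1 := by
  refine le_of_tendsto ((tendsto_qPoch hq x).sub_const 1).norm (Eventually.of_forall fun n => ?_)
  have h := Finset.norm_prod_one_add_sub_one_le (Finset.range n) fun i => -(x * q ^ i)
  simp only [← sub_eq_add_neg] at h
  refine h.trans (sub_le_sub_right (Real.exp_le_exp.2 ?_) 1)
  refine ((summable_norm_mul_pow hq x).sum_le_tsum _ fun _ _ => norm_nonneg _).trans ?_
  simp only [norm_neg, norm_mul, norm_pow]
  rw [tsum_mul_left, tsum_geometric_of_lt_one (norm_nonneg _) hq, div_eq_mul_inv]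

theorem norm_qPochInf_le (hq : ‖q‖ < 1) {x : ℂ} {X : ℝ} (hx : ‖x‖ ≤ X) :
    ‖qPochInf x q‖ ≤ Real.exp (X / (1 - ‖q‖)) := by
  have h := norm_qPochInf_sub_one_le hq x
  have h2 := norm_le_norm_sub_add (qPochInf x q) 1
  have h3 : Real.exp (‖x‖ / (1 - ‖q‖)) ≤ Real.exp (X / (1 - ‖q‖)) :=
    Real.exp_le_exp.2 (div_le_div_of_nonneg_right hx (by linarith))
  rw [norm_one] at h2
  linarith

theorem tendsto_qPochInf_one (hq : ‖q‖ < 1) {u : ℕ → ℂ} (hu : Tendsto u atTop (𝓝 0)) :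
    Tendsto (fun n => qPochInf (u n) q) atTop (𝓝 1) := by
  rw [tendsto_iff_norm_sub_tendsto_zero]
  refine squeeze_zero (fun _ => norm_nonneg _) (fun n => norm_qPochInf_sub_one_le hq (u n)) ?_
  have : Tendsto (fun n => Real.exp (‖u n‖ / (1 - ‖q‖)) - 1) atTop
      (𝓝 (Real.exp (‖(0 : ℂ)‖ / (1 - ‖q‖)) - 1)) :=
    ((Real.continuous_exp.tendsto _).comp (hu.norm.div_const _)).sub_const 1
  simpa using this

end QPochhammer

/-! ### A ratio-test majorant. -/

section Majorant

/-- A product of four finite products `∏ (Xⱼ + A r ^ (i + 1))`, weighted by `W ^ k`, is summable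
as soon as the limiting ratio `X₁ X₂ X₃ X₄ W` is less than `1`. -/
theorem summable_prod_majorant {r A W X₁ X₂ X₃ X₄ : ℝ} (hr0 : 0 < r) (hr1 : r < 1) (hA : 0 < A)
    (hW : 0 < W) (h₁ : 0 ≤ X₁) (h₂ : 0 ≤ X₂) (h₃ : 0 ≤ X₃) (h₄ : 0 ≤ X₄)
    (h : X₁ * X₂ * X₃ * X₄ * W < 1) :
    Summable fun k : ℕ => (∏ i ∈ Finset.range k, (X₁ + A * r ^ (i + 1))) *
      (∏ i ∈ Finset.range k, (X₂ + A * r ^ (i + 1))) *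
      (∏ i ∈ Finset.range k, (X₃ + A * r ^ (i + 1))) *
      (∏ i ∈ Finset.range k, (X₄ + A * r ^ (i + 1))) * W ^ k := by
  have hpos : ∀ {X : ℝ}, 0 ≤ X → ∀ k : ℕ, 0 < ∏ i ∈ Finset.range k, (X + A * r ^ (i + 1)) :=
    fun hX k => Finset.prod_pos fun i _ => by positivity
  have hlim : ∀ X : ℝ, Tendsto (fun k : ℕ => X + A * r ^ (k + 1)) atTop (𝓝 X) := fun X => by
    simpa using (((tendsto_pow_atTop_nhds_zero_of_lt_one hr0.le hr1).comp
      (tendsto_add_atTop_nat 1)).const_mul A).const_add X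
  refine summable_of_ratio_test_tendsto_lt_one h (Eventually.of_forall fun k => ?_)
    ((((((hlim X₁).mul (hlim X₂)).mul (hlim X₃)).mul (hlim X₄)).mul_const W).congr fun k => ?_)
  · have := hpos h₁ k; have := hpos h₂ k; have := hpos h₃ k; have := hpos h₄ k
    positivity
  · have p₁ := hpos h₁ k; have p₂ := hpos h₂ k; have p₃ := hpos h₃ k; have p₄ := hpos h₄ k
    rw [← norm_div, Real.norm_of_nonneg]
    · simp only [Finset.prod_range_succ, pow_succ]
      field_simp
    · have := hpos h₁ (k + 1); have := hpos h₂ (k + 1)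
      have := hpos h₃ (k + 1); have := hpos h₄ (k + 1)
      positivity

end Majorant

/-! ### Normalised very-well-poised series and their contiguous relation. -/

section VeryWellPoised

variable {q a b : ℂ}

/-- The contribution of a parameter `x` to the `k`-th term of the very-well-poised series: it is
`(-q a / x; q)_k x ^ k / (-x / b; q)_{k+1}`, multiplied by `(-x / a, -x / b; q)_∞` to clear the
denominators. -/
def vwpFactor (q a b x : ℂ) (k : ℕ) : ℂ :=
  (∏ i ∈ Finset.range k, (x + a * q ^ (i + 1))) * qPochInf (-x * q ^ (k + 1) / b) q *
    qPochInf (-x / a) q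

/-- The `k`-th term of the very-well-poised series without its very-well-poised part. -/
def vwpKernel (q a b c d e h : ℂ) (k : ℕ) : ℂ :=
  vwpFactor q a b c k * vwpFactor q a b d k * vwpFactor q a b e k * vwpFactor q a b h k /
    (a ^ 2 * b ^ 2 * q) ^ k

/-- The `k`-th term of one half of the bilateral very-well-poised series `₆ψ₆`, normalised so as
to have no denominators. -/
def vwpTerm (q a b c d e h : ℂ) (k : ℕ) : ℂ :=
  (1 - a * q ^ (2 * k + 1) / b) * vwpKernel q a b c d e h k

/-- The normalised bilateral very-well-poised series `₆ψ₆`, as a difference of two unilateral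
series that are interchanged with `a` and `b`. -/
def vwpDiff (q a b c d e h : ℂ) : ℂ :=
  1 / b * ∑' k, vwpTerm q a b c d e h k - 1 / a * ∑' k, vwpTerm q b a c d e h k

/-- The factor by which the `k`-th term changes when a parameter is divided by `q`. -/
def vwpShift (q a b x : ℂ) (k : ℕ) : ℂ := (1 + x * q ^ (k + 1) / b) * (1 + x / (a * q ^ k))

theorem vwpFactor_succ (hq : ‖q‖ < 1) (x : ℂ) (k : ℕ) :
    (1 + x * q ^ (k + 1) / b) * vwpFactor q a b x (k + 1) =
      (x + a * q ^ (k + 1)) * vwpFactor q a b x k := by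
  have h := qPochInf_eq_mul hq (-x * q ^ (k + 1) / b)
  rw [show -x * q ^ (k + 1) / b * q = -x * q ^ (k + 1 + 1) / b by ring] at h
  simp only [vwpFactor, Finset.prod_range_succ, h]
  ring

theorem vwpFactor_zero (hq : ‖q‖ < 1) (x : ℂ) :
    (1 + x / b) * vwpFactor q a b x 0 = qPochInf (-x / b) q * qPochInf (-x / a) q := by
  have h := qPochInf_eq_mul hq (-x / b)
  rw [show -x / b * q = -x * q ^ (0 + 1) / b by ring] at h
  simp only [vwpFactor, Finset.prod_range_zero, h]
  ring

/-- Replacing `x q` by `x` moves each of the three products by one index, so only end factors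
survive; the factor `x + a` gained by one product is lost by another. -/
theorem vwpFactor_eq_mul_shift (hq0 : q ≠ 0) (hq : ‖q‖ < 1) (ha : a ≠ 0) (x : ℂ) (k : ℕ) :
    vwpFactor q a b x k = vwpFactor q a b (x * q) k * vwpShift q a b x k := by
  have h1 : (∏ i ∈ Finset.range k, (x * q + a * q ^ (i + 1))) =
      q ^ k * ∏ i ∈ Finset.range k, (x + a * q ^ i) := by
    rw [← Finset.card_range k, ← Finset.prod_const, Finset.card_range, ← Finset.prod_mul_distrib]
    exact Finset.prod_congr rfl fun i _ => by ring
  have h2 : (∏ i ∈ Finset.range k, (x + a * q ^ (i + 1))) * (x + a) =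
      (∏ i ∈ Finset.range k, (x + a * q ^ i)) * (x + a * q ^ k) := by
    rw [← Finset.prod_range_succ, Finset.prod_range_succ']
    simp
  have h3 := qPochInf_eq_mul hq (-x * q ^ (k + 1) / b)
  rw [show -x * q ^ (k + 1) / b * q = -(x * q) * q ^ (k + 1) / b by ring] at h3
  have h4 := qPochInf_eq_mul hq (-x / a)
  rw [show -x / a * q = -(x * q) / a by ring] at h4
  have h5 : (1 - -x / a) = (x + a) / a := by field_simp; ring
  have h6 : (1 + x / (a * q ^ k)) * q ^ k = (x + a * q ^ k) / a := by
    field_simp; ring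
  simp only [vwpFactor, vwpShift, h1, h3, h4, h5]
  linear_combination (qPochInf (-(x * q) * q ^ (k + 1) / b) q * qPochInf (-(x * q) / a) q *
    (1 - -x * q ^ (k + 1) / b) / a) * h2 -
    (∏ i ∈ Finset.range k, (x + a * q ^ i)) * (qPochInf (-(x * q) * q ^ (k + 1) / b) q *
    qPochInf (-(x * q) / a) q * (1 - -x * q ^ (k + 1) / b)) * h6

theorem vwpTerm_eq_mul_shift (hq0 : q ≠ 0) (hq : ‖q‖ < 1) (ha : a ≠ 0) (c d e h : ℂ) (k : ℕ) :
    vwpTerm q a b c d e h k = vwpTerm q a b c d e (h * q) k * vwpShift q a b h k := by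
  simp only [vwpTerm, vwpKernel, vwpFactor_eq_mul_shift hq0 hq ha h]
  ring

/-- The constant in the bound for `vwpFactor`. -/
def vwpConst (q a b : ℂ) (X : ℝ) : ℝ :=
  Real.exp (X / ‖b‖ / (1 - ‖q‖)) * Real.exp (X / ‖a‖ / (1 - ‖q‖))

/-- The bound depends on `X` rather than on `x`, so that it holds simultaneously for all `h q^m`. -/
theorem norm_vwpFactor_le (hq : ‖q‖ < 1) {x : ℂ} {X : ℝ} (hx : ‖x‖ ≤ X) (k : ℕ) :
    ‖vwpFactor q a b x k‖ ≤
      (∏ i ∈ Finset.range k, (X + ‖a‖ * ‖q‖ ^ (i + 1))) * vwpConst q a b X := by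
  have h1 : ‖∏ i ∈ Finset.range k, (x + a * q ^ (i + 1))‖ ≤
      ∏ i ∈ Finset.range k, (X + ‖a‖ * ‖q‖ ^ (i + 1)) := by
    rw [norm_prod]
    refine Finset.prod_le_prod (fun _ _ => norm_nonneg _) fun i _ => ?_
    refine (norm_add_le _ _).trans ?_
    rw [norm_mul, norm_pow]
    gcongr
  have h2 : ‖qPochInf (-x * q ^ (k + 1) / b) q‖ ≤ Real.exp (X / ‖b‖ / (1 - ‖q‖)) := by
    refine norm_qPochInf_le hq ?_
    rw [norm_div, norm_mul, norm_neg, norm_pow]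
    refine div_le_div_of_nonneg_right (le_trans ?_ hx) (norm_nonneg _)
    exact mul_le_of_le_one_right (norm_nonneg _) (pow_le_one₀ (norm_nonneg _) hq.le)
  have h3 : ‖qPochInf (-x / a) q‖ ≤ Real.exp (X / ‖a‖ / (1 - ‖q‖)) := by
    refine norm_qPochInf_le hq ?_
    rw [norm_div, norm_neg]
    exact div_le_div_of_nonneg_right hx (norm_nonneg _)
  rw [vwpFactor, vwpConst, norm_mul, norm_mul, ← mul_assoc]
  have hX : 0 ≤ X := (norm_nonneg _).trans hx
  gcongr

/-- The product of norms of finite products that majorises the very-well-poised series. -/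
def vwpMajorant (q a : ℂ) (X₁ X₂ X₃ X₄ : ℝ) (k : ℕ) : ℝ :=
  (∏ i ∈ Finset.range k, (X₁ + ‖a‖ * ‖q‖ ^ (i + 1))) *
    (∏ i ∈ Finset.range k, (X₂ + ‖a‖ * ‖q‖ ^ (i + 1))) *
    (∏ i ∈ Finset.range k, (X₃ + ‖a‖ * ‖q‖ ^ (i + 1))) *
    (∏ i ∈ Finset.range k, (X₄ + ‖a‖ * ‖q‖ ^ (i + 1)))

theorem norm_vwpKernel_le (hq : ‖q‖ < 1) {c d e h : ℂ} {H : ℝ} (hh : ‖h‖ ≤ H) (k : ℕ) :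
    ‖vwpKernel q a b c d e h k‖ ≤
      vwpConst q a b ‖c‖ * vwpConst q a b ‖d‖ * vwpConst q a b ‖e‖ * vwpConst q a b H *
        (vwpMajorant q a ‖c‖ ‖d‖ ‖e‖ H k * (‖a ^ 2 * b ^ 2 * q‖⁻¹) ^ k) := by
  have hc := norm_vwpFactor_le (a := a) (b := b) hq (le_refl ‖c‖) k
  have hd := norm_vwpFactor_le (a := a) (b := b) hq (le_refl ‖d‖) k
  have he := norm_vwpFactor_le (a := a) (b := b) hq (le_refl ‖e‖) k
  have hh := norm_vwpFactor_le (a := a) (b := b) hq hh k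
  rw [vwpKernel, norm_div, norm_mul, norm_mul, norm_mul, norm_pow, div_eq_mul_inv, ← inv_pow]
  calc _ ≤ _ := mul_le_mul_of_nonneg_right (mul_le_mul (mul_le_mul (mul_le_mul hc hd
        (norm_nonneg _) ((norm_nonneg _).trans hc)) he (norm_nonneg _)
        (mul_nonneg ((norm_nonneg _).trans hc) ((norm_nonneg _).trans hd))) hh (norm_nonneg _)
        (mul_nonneg (mul_nonneg ((norm_nonneg _).trans hc) ((norm_nonneg _).trans hd))
          ((norm_nonneg _).trans he))) (by positivity)
    _ = _ := by rw [vwpMajorant]; ring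

theorem norm_vwpTerm_le (hq : ‖q‖ < 1) {c d e h : ℂ} {H : ℝ} (hh : ‖h‖ ≤ H) (k : ℕ) :
    ‖vwpTerm q a b c d e h k‖ ≤ (1 + ‖a‖ / ‖b‖) *
      (vwpConst q a b ‖c‖ * vwpConst q a b ‖d‖ * vwpConst q a b ‖e‖ * vwpConst q a b H *
        (vwpMajorant q a ‖c‖ ‖d‖ ‖e‖ H k * (‖a ^ 2 * b ^ 2 * q‖⁻¹) ^ k)) := by
  rw [vwpTerm, norm_mul]
  refine mul_le_mul ?_ (norm_vwpKernel_le hq hh k) (norm_nonneg _) (by positivity)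
  refine (norm_sub_le _ _).trans ?_
  rw [norm_one, norm_div, norm_mul, norm_pow]
  gcongr
  exact mul_le_of_le_one_right (norm_nonneg _) (pow_le_one₀ (norm_nonneg _) hq.le)

theorem summable_vwpMajorant (hq0 : q ≠ 0) (hq : ‖q‖ < 1) (ha : a ≠ 0) (hb : b ≠ 0)
    {c d e h : ℂ} (hz : ‖c * d * e * h / (a ^ 2 * b ^ 2 * q)‖ < 1) :
    Summable fun k => vwpMajorant q a ‖c‖ ‖d‖ ‖e‖ ‖h‖ k * (‖a ^ 2 * b ^ 2 * q‖⁻¹) ^ k := by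
  refine summable_prod_majorant (norm_pos_iff.2 hq0) hq (norm_pos_iff.2 ha)
    (inv_pos.2 (norm_pos_iff.2 (by positivity))) (norm_nonneg _) (norm_nonneg _)
    (norm_nonneg _) (norm_nonneg _) ?_
  rwa [norm_div, norm_mul, norm_mul, norm_mul, div_eq_mul_inv] at hz

theorem summable_vwpTerm (hq0 : q ≠ 0) (hq : ‖q‖ < 1) (ha : a ≠ 0) (hb : b ≠ 0)
    {c d e h : ℂ} (hz : ‖c * d * e * h / (a ^ 2 * b ^ 2 * q)‖ < 1) :
    Summable (vwpTerm q a b c d e h) :=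
  .of_norm_bounded (((summable_vwpMajorant hq0 hq ha hb hz).mul_left _).mul_left _)
    (norm_vwpTerm_le hq le_rfl)

/-- The sequence whose differences express the contiguous relation. -/
def vwpCert (q a b c d e h : ℂ) (k : ℕ) : ℂ :=
  (1 + c * q ^ k / b) * (1 + d * q ^ k / b) * (1 + e * q ^ k / b) * (1 + h * q ^ k / b) *
    vwpKernel q a b c d e h k / q ^ k

/-- The point is the symmetry of the value in `a` and `b`. -/
theorem vwpCert_zero (hq : ‖q‖ < 1) (c d e h : ℂ) :
    vwpCert q a b c d e h 0 =
      qPochInf (-c / b) q * qPochInf (-c / a) q * (qPochInf (-d / b) q * qPochInf (-d / a) q) *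
      (qPochInf (-e / b) q * qPochInf (-e / a) q) *
      (qPochInf (-h / b) q * qPochInf (-h / a) q) := by
  simp only [← vwpFactor_zero hq, vwpCert, vwpKernel, pow_zero, mul_one, div_one]
  ring

theorem vwpCert_succ (hq : ‖q‖ < 1) (c d e h : ℂ) (k : ℕ) :
    vwpCert q a b c d e h (k + 1) =
      (c + a * q ^ (k + 1)) * (d + a * q ^ (k + 1)) * (e + a * q ^ (k + 1)) *
      (h + a * q ^ (k + 1)) / (a ^ 2 * b ^ 2 * q) * vwpKernel q a b c d e h k / q ^ (k + 1) := by
  have hc := vwpFactor_succ (a := a) (b := b) hq c k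
  have hd := vwpFactor_succ (a := a) (b := b) hq d k
  have he := vwpFactor_succ (a := a) (b := b) hq e k
  have hh := vwpFactor_succ (a := a) (b := b) hq h k
  calc _ = ((1 + c * q ^ (k + 1) / b) * vwpFactor q a b c (k + 1)) *
        ((1 + d * q ^ (k + 1) / b) * vwpFactor q a b d (k + 1)) *
        ((1 + e * q ^ (k + 1) / b) * vwpFactor q a b e (k + 1)) *
        ((1 + h * q ^ (k + 1) / b) * vwpFactor q a b h (k + 1)) /
        (a ^ 2 * b ^ 2 * q) ^ (k + 1) / q ^ (k + 1) := by
        rw [vwpCert, vwpKernel]; ring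
    _ = _ := by
        rw [hc, hd, he, hh, vwpKernel, pow_succ (a ^ 2 * b ^ 2 * q) k, mul_comm (_ ^ k)]
        simp only [div_eq_mul_inv, mul_inv]
        ring

/-- Every term is a multiple of the kernel with parameter `h q`; after removing it, what remains is
a rational identity in `q ^ k`. -/
theorem vwpTerm_contiguous (hq0 : q ≠ 0) (hq : ‖q‖ < 1) (ha : a ≠ 0) (hb : b ≠ 0)
    (c d e h : ℂ) (k : ℕ) :
    (1 - c * d * e * h / (a ^ 2 * b ^ 2 * q)) * vwpTerm q a b c d e h k -
      (1 - c * h / (a * b)) * (1 - d * h / (a * b)) * (1 - e * h / (a * b)) *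
        vwpTerm q a b c d e (h * q) k =
      -(h / a) * (vwpCert q a b c d e (h * q) (k + 1) - vwpCert q a b c d e (h * q) k) := by
  rw [vwpTerm_eq_mul_shift hq0 hq ha, vwpCert_succ hq, vwpCert, vwpTerm, vwpShift]
  have hX : q ^ k ≠ 0 := pow_ne_zero _ hq0
  have h2 : q ^ (2 * k + 1) = (q ^ k) ^ 2 * q := by ring
  rw [h2, pow_succ q k]
  generalize q ^ k = X at *
  generalize vwpKernel q a b c d e (h * q) k = M
  field_simp
  ring

theorem tendsto_vwpCert (hq0 : q ≠ 0) (hq : ‖q‖ < 1) (ha : a ≠ 0) (hb : b ≠ 0)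
    {c d e h : ℂ} (hz : ‖c * d * e * h / (a ^ 2 * b ^ 2 * q)‖ < 1) :
    Tendsto (vwpCert q a b c d e (h * q)) atTop (𝓝 0) := by
  have hr : 0 < ‖q‖ := norm_pos_iff.2 hq0
  -- The extra `‖q‖⁻¹` accounts for the division by `q ^ k` in `vwpCert`. It is compensated by the
  -- parameter `h * q`, so the limiting ratio is exactly the norm in `hz`.
  have hM := summable_prod_majorant (r := ‖q‖) (A := ‖a‖) (W := ‖a ^ 2 * b ^ 2 * q‖⁻¹ * ‖q‖⁻¹)
    (X₁ := ‖c‖) (X₂ := ‖d‖) (X₃ := ‖e‖) (X₄ := ‖h * q‖) hr hq (norm_pos_iff.2 ha)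
    (mul_pos (inv_pos.2 (norm_pos_iff.2 (by positivity))) (inv_pos.2 hr)) (norm_nonneg _)
    (norm_nonneg _) (norm_nonneg _) (norm_nonneg _) (by
      rw [norm_div, norm_mul, norm_mul, norm_mul, div_eq_mul_inv] at hz
      refine lt_of_eq_of_lt ?_ hz
      rw [norm_mul h q]
      field_simp)
  have hbd : ∀ x : ℂ, ∀ k : ℕ, ‖1 + x * q ^ k / b‖ ≤ 1 + ‖x‖ / ‖b‖ := fun x k => by
    refine (norm_add_le _ _).trans ?_
    rw [norm_one, norm_div, norm_mul, norm_pow]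
    gcongr
    exact mul_le_of_le_one_right (norm_nonneg _) (pow_le_one₀ (norm_nonneg _) hq.le)
  have h0 := (hM.mul_left ((1 + ‖c‖ / ‖b‖) * (1 + ‖d‖ / ‖b‖) * (1 + ‖e‖ / ‖b‖) *
    (1 + ‖h * q‖ / ‖b‖) * (vwpConst q a b ‖c‖ * vwpConst q a b ‖d‖ * vwpConst q a b ‖e‖ *
      vwpConst q a b ‖h * q‖))).tendsto_atTop_zero
  refine squeeze_zero_norm (fun k => ?_) h0
  have hk := norm_vwpKernel_le (a := a) (b := b) (c := c) (d := d) (e := e) hq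
    (le_refl ‖h * q‖) k
  rw [vwpCert, norm_div, norm_mul, norm_mul, norm_mul, norm_mul, norm_pow]
  calc _ ≤ (1 + ‖c‖ / ‖b‖) * (1 + ‖d‖ / ‖b‖) * (1 + ‖e‖ / ‖b‖) * (1 + ‖h * q‖ / ‖b‖) *
        (vwpConst q a b ‖c‖ * vwpConst q a b ‖d‖ * vwpConst q a b ‖e‖ *
          vwpConst q a b ‖h * q‖ * (vwpMajorant q a ‖c‖ ‖d‖ ‖e‖ ‖h * q‖ k *
            (‖a ^ 2 * b ^ 2 * q‖⁻¹) ^ k)) / ‖q‖ ^ k := by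
        gcongr <;> exact hbd _ _
    _ = _ := by
        rw [vwpMajorant, mul_pow, inv_pow ‖q‖ k]
        ring

theorem tsum_vwpTerm_contiguous (hq0 : q ≠ 0) (hq : ‖q‖ < 1) (ha : a ≠ 0) (hb : b ≠ 0)
    {c d e h : ℂ} (hz : ‖c * d * e * h / (a ^ 2 * b ^ 2 * q)‖ < 1) :
    (1 - c * d * e * h / (a ^ 2 * b ^ 2 * q)) * ∑' k, vwpTerm q a b c d e h k -
      (1 - c * h / (a * b)) * (1 - d * h / (a * b)) * (1 - e * h / (a * b)) *
        ∑' k, vwpTerm q a b c d e (h * q) k =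
      h / a * vwpCert q a b c d e (h * q) 0 := by
  have hzq : ‖c * d * e * (h * q) / (a ^ 2 * b ^ 2 * q)‖ < 1 := by
    rw [show c * d * e * (h * q) / (a ^ 2 * b ^ 2 * q) =
      c * d * e * h / (a ^ 2 * b ^ 2 * q) * q by ring, norm_mul]
    exact mul_lt_one_of_nonneg_of_lt_one_left (norm_nonneg _) hz hq.le
  have h1 := (((summable_vwpTerm hq0 hq ha hb hz).hasSum.mul_left
    (1 - c * d * e * h / (a ^ 2 * b ^ 2 * q))).sub
    ((summable_vwpTerm hq0 hq ha hb hzq).hasSum.mul_left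
    ((1 - c * h / (a * b)) * (1 - d * h / (a * b)) * (1 - e * h / (a * b))))).tendsto_sum_nat
  refine tendsto_nhds_unique h1 ?_
  simp only [vwpTerm_contiguous hq0 hq ha hb, ← Finset.mul_sum, Finset.sum_range_sub]
  have := ((tendsto_vwpCert hq0 hq ha hb hz).sub_const
    (vwpCert q a b c d e (h * q) 0)).const_mul (-(h / a))
  convert! this using 2
  ring

/-- Each half satisfies an inhomogeneous recurrence. With the weights `1 / b` and `1 / a` both
inhomogeneities become `h / (a b)` times the same symmetric boundary value, and cancel. -/
theorem vwpDiff_contiguous (hq0 : q ≠ 0) (hq : ‖q‖ < 1) (ha : a ≠ 0) (hb : b ≠ 0)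
    {c d e h : ℂ} (hz : ‖c * d * e * h / (a ^ 2 * b ^ 2 * q)‖ < 1) :
    (1 - c * d * e * h / (a ^ 2 * b ^ 2 * q)) * vwpDiff q a b c d e h =
      (1 - c * h / (a * b)) * (1 - d * h / (a * b)) * (1 - e * h / (a * b)) *
        vwpDiff q a b c d e (h * q) := by
  have h1 := tsum_vwpTerm_contiguous hq0 hq ha hb hz
  have h2 := tsum_vwpTerm_contiguous hq0 hq hb ha (c := c) (d := d) (e := e) (h := h)
    (by rwa [mul_comm (b ^ 2)])
  rw [mul_comm (b ^ 2), mul_comm b a] at h2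
  rw [vwpCert_zero hq] at h1 h2
  rw [vwpDiff, vwpDiff]
  linear_combination 1 / b * h1 - 1 / a * h2

end VeryWellPoised

/-! ### Bailey's `₆ψ₆` summation. -/

section Bailey

variable {q a b : ℂ}

theorem norm_mul_mul_pow_lt_one (hq : ‖q‖ < 1) {w : ℂ} (hw : ‖w‖ < 1) (m : ℕ) :
    ‖w * q ^ m‖ < 1 := by
  rw [norm_mul, norm_pow]
  exact mul_lt_one_of_nonneg_of_lt_one_left (norm_nonneg _) hw
    (pow_le_one₀ (norm_nonneg _) hq.le)

theorem vwpDiff_iterate (hq0 : q ≠ 0) (hq : ‖q‖ < 1) (ha : a ≠ 0) (hb : b ≠ 0)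
    {c d e h : ℂ} (hz : ‖c * d * e * h / (a ^ 2 * b ^ 2 * q)‖ < 1) (m : ℕ) :
    qPoch (c * d * e * h / (a ^ 2 * b ^ 2 * q)) q m * vwpDiff q a b c d e h =
      qPoch (c * h / (a * b)) q m * qPoch (d * h / (a * b)) q m * qPoch (e * h / (a * b)) q m *
        vwpDiff q a b c d e (h * q ^ m) := by
  induction m with
  | zero => simp [qPoch]
  | succ m ih =>
    have h1 : c * d * e * (h * q ^ m) / (a ^ 2 * b ^ 2 * q) =
      c * d * e * h / (a ^ 2 * b ^ 2 * q) * q ^ m := by ring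
    have h2 := vwpDiff_contiguous hq0 hq ha hb (c := c) (d := d) (e := e) (h := h * q ^ m)
      (h1 ▸ norm_mul_mul_pow_lt_one hq hz m)
    rw [h1, show h * q ^ m * q = h * q ^ (m + 1) by ring,
      show ∀ x : ℂ, x * (h * q ^ m) / (a * b) = x * h / (a * b) * q ^ m from fun x => by ring,
      show d * (h * q ^ m) / (a * b) = d * h / (a * b) * q ^ m by ring,
      show e * (h * q ^ m) / (a * b) = e * h / (a * b) * q ^ m by ring] at h2
    simp only [qPoch_succ]
    linear_combination (1 - c * d * e * h / (a ^ 2 * b ^ 2 * q) * q ^ m) * ih +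
      qPoch (c * h / (a * b)) q m * qPoch (d * h / (a * b)) q m * qPoch (e * h / (a * b)) q m * h2

theorem tendsto_vwpTerm (hq : ‖q‖ < 1) (c d e h : ℂ) (k : ℕ) :
    Tendsto (fun m : ℕ => vwpTerm q a b c d e (h * q ^ m) k) atTop
      (𝓝 (vwpTerm q a b c d e 0 k)) := by
  have h0 : Tendsto (fun m : ℕ => h * q ^ m) atTop (𝓝 0) := by
    simpa using (tendsto_pow_atTop_nhds_zero_of_norm_lt_one hq).const_mul h
  have h1 : Tendsto (fun m : ℕ => vwpFactor q a b (h * q ^ m) k) atTop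
      (𝓝 (vwpFactor q a b 0 k)) := by
    simp only [vwpFactor, neg_zero, zero_mul, zero_div, qPochInf_zero]
    refine (Tendsto.mul (tendsto_finsetProd _ fun i _ => h0.add_const _)
      (tendsto_qPochInf_one hq ?_)).mul (tendsto_qPochInf_one hq ?_)
    · simpa using (h0.neg.mul_const (q ^ (k + 1))).div_const b
    · simpa using h0.neg.div_const a
  exact ((h1.const_mul _).div_const _).const_mul _

theorem tendsto_tsum_vwpTerm (hq0 : q ≠ 0) (hq : ‖q‖ < 1) (ha : a ≠ 0) (hb : b ≠ 0)
    {c d e h : ℂ} (hz : ‖c * d * e * h / (a ^ 2 * b ^ 2 * q)‖ < 1) :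
    Tendsto (fun m : ℕ => ∑' k, vwpTerm q a b c d e (h * q ^ m) k) atTop
      (𝓝 (∑' k, vwpTerm q a b c d e 0 k)) := by
  -- The majorant built from `‖h‖` serves for all `m`, because `‖h q^m‖ ≤ ‖h‖`.
  refine tendsto_tsum_of_dominated_convergence
    (((summable_vwpMajorant hq0 hq ha hb hz).mul_left _).mul_left _)
    (tendsto_vwpTerm hq c d e h) (Eventually.of_forall fun m k => norm_vwpTerm_le hq ?_ k)
  rw [norm_mul, norm_pow]
  exact mul_le_of_le_one_right (norm_nonneg _) (pow_le_one₀ (norm_nonneg _) hq.le)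

/-- Iterate the homogeneous recurrence `m` times and let `m → ∞`. -/
theorem vwpDiff_eliminate (hq0 : q ≠ 0) (hq : ‖q‖ < 1) (ha : a ≠ 0) (hb : b ≠ 0)
    {c d e h : ℂ} (hz : ‖c * d * e * h / (a ^ 2 * b ^ 2 * q)‖ < 1) :
    qPochInf (c * d * e * h / (a ^ 2 * b ^ 2 * q)) q * vwpDiff q a b c d e h =
      qPochInf (c * h / (a * b)) q * qPochInf (d * h / (a * b)) q *
        qPochInf (e * h / (a * b)) q * vwpDiff q a b c d e 0 := by
  have h1 : Tendsto (fun m : ℕ => vwpDiff q a b c d e (h * q ^ m)) atTop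
      (𝓝 (vwpDiff q a b c d e 0)) :=
    ((tendsto_tsum_vwpTerm hq0 hq ha hb hz).const_mul _).sub
      ((tendsto_tsum_vwpTerm hq0 hq hb ha (by rwa [mul_comm (b ^ 2)])).const_mul _)
  refine tendsto_nhds_unique ((tendsto_qPoch hq _).mul_const _) ?_
  simp only [vwpDiff_iterate hq0 hq ha hb hz]
  exact (((tendsto_qPoch hq _).mul (tendsto_qPoch hq _)).mul (tendsto_qPoch hq _)).mul h1

theorem vwpDiff_swap_right (c d e h : ℂ) :
    vwpDiff q a b c d e h = vwpDiff q a b c d h e := by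
  simp only [vwpDiff, vwpTerm, vwpKernel, mul_right_comm]

theorem vwpDiff_swap_outer (c d e h : ℂ) :
    vwpDiff q a b c d e h = vwpDiff q a b h d e c := by
  have : ∀ a b : ℂ, vwpTerm q a b c d e h = vwpTerm q a b h d e c := fun a b => by
    ext k
    simp only [vwpTerm, vwpKernel]
    ring
  simp only [vwpDiff, this]

theorem vwpDiff_swap_inner (c d e h : ℂ) :
    vwpDiff q a b c d e h = vwpDiff q a b c h e d := by
  have : ∀ a b : ℂ, vwpTerm q a b c d e h = vwpTerm q a b c h e d := fun a b => by
    ext k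
    simp only [vwpTerm, vwpKernel]
    ring
  simp only [vwpDiff, this]

theorem vwpDiff_one_parameter (hq0 : q ≠ 0) (hq : ‖q‖ < 1) (ha : a ≠ 0) (hb : b ≠ 0) (c : ℂ) :
    vwpDiff q a b c 0 0 0 = vwpDiff q a b 0 0 0 0 := by
  have := vwpDiff_eliminate hq0 hq ha hb (c := 0) (d := 0) (e := 0) (h := c) (by simp)
  simp only [zero_mul, zero_div, qPochInf_zero, one_mul] at this
  rw [vwpDiff_swap_outer, this]

theorem vwpDiff_two_parameters (hq0 : q ≠ 0) (hq : ‖q‖ < 1) (ha : a ≠ 0) (hb : b ≠ 0)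
    (c d : ℂ) :
    vwpDiff q a b c d 0 0 = qPochInf (c * d / (a * b)) q * vwpDiff q a b 0 0 0 0 := by
  have := vwpDiff_eliminate hq0 hq ha hb (c := c) (d := 0) (e := 0) (h := d) (by simp)
  simp only [zero_mul, zero_div, mul_zero, qPochInf_zero, one_mul, mul_one,
    vwpDiff_one_parameter hq0 hq ha hb] at this
  rw [vwpDiff_swap_inner, this]

/-- The Jacobi triple product, in the form needed here, as the special case of the
very-well-poised series in which only one term survives. -/
theorem vwpDiff_zero (hq0 : q ≠ 0) (hq : ‖q‖ < 1) (ha : a ≠ 0) (hb : b ≠ 0) :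
    vwpDiff q a b 0 0 0 0 =
      (1 / b - 1 / a) * (qPochInf q q * qPochInf (q * a / b) q * qPochInf (q * b / a) q) := by
  have hqq : qPochInf q q ≠ 0 := qPochInf_ne_zero_of_norm_lt_one hq hq
  -- The parameter `-a` brings in `(1; q)_∞ = 0` and kills the first series. The parameter `-(b q)`
  -- kills all terms of the second with `k > 0`, through the factor `i = 0`. The product formula
  -- contributes `(q; q)_∞`, which is nonzero and can be cancelled.
  have h1 := vwpDiff_two_parameters hq0 hq ha hb (-a) (-(b * q))
  rw [show -a * -(b * q) / (a * b) = q by field_simp] at h1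
  have h2 : ∀ k, vwpTerm q a b (-a) (-(b * q)) 0 0 k = 0 := fun k => by
    have : vwpFactor q a b (-a) k = 0 := by
      rw [vwpFactor, neg_neg, div_self ha, qPochInf_one hq, mul_zero]
    simp [vwpTerm, vwpKernel, this]
  have h3 : ∑' k, vwpTerm q b a (-a) (-(b * q)) 0 0 k = vwpTerm q b a (-a) (-(b * q)) 0 0 0 := by
    refine tsum_eq_single 0 fun k hk => ?_
    have : vwpFactor q b a (-(b * q)) k = 0 := by
      rw [vwpFactor, Finset.prod_eq_zero (Finset.mem_range.2 (Nat.pos_of_ne_zero hk)) (by simp),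
        zero_mul, zero_mul]
    simp [vwpTerm, vwpKernel, this]
  rw [vwpDiff, h3, tsum_congr h2, tsum_zero] at h1
  simp only [vwpTerm, vwpKernel, vwpFactor, Finset.prod_range_zero, pow_zero,
    neg_zero, zero_mul, zero_div, qPochInf_zero, mul_one, one_mul, mul_zero, zero_add, pow_one,
    neg_neg, div_one] at h1
  rw [mul_div_cancel_left₀ q ha, mul_div_cancel_left₀ q hb] at h1
  have h4 := qPochInf_eq_mul hq (a / b)
  have h5 := qPochInf_eq_mul hq (b * q / a)
  rw [show b * q / a * q = b * q * q / a by ring] at h5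
  rw [show a / b * q = q * a / b by ring] at h4
  rw [mul_comm q b, h5]
  rw [h4] at h1
  refine mul_left_cancel₀ hqq (h1.symm.trans ?_)
  field_simp
  ring

/-- Bailey's sum of the bilateral very-well-poised `₆ψ₆` series. -/
theorem vwpDiff_eq (hq0 : q ≠ 0) (hq : ‖q‖ < 1) (ha : a ≠ 0) (hb : b ≠ 0)
    {c d e h : ℂ} (hz : ‖c * d * e * h / (a ^ 2 * b ^ 2 * q)‖ < 1) :
    qPochInf (c * d * e * h / (a ^ 2 * b ^ 2 * q)) q * vwpDiff q a b c d e h =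
      (1 / b - 1 / a) * (qPochInf q q * qPochInf (q * a / b) q * qPochInf (q * b / a) q) *
      (qPochInf (c * h / (a * b)) q * qPochInf (d * h / (a * b)) q *
        qPochInf (e * h / (a * b)) q * qPochInf (c * d / (a * b)) q *
        qPochInf (c * e / (a * b)) q * qPochInf (d * e / (a * b)) q) := by
  have h1 := vwpDiff_eliminate hq0 hq ha hb (c := c) (d := d) (e := 0) (h := e) (by simp)
  simp only [mul_zero, zero_mul, zero_div, qPochInf_zero, mul_one, one_mul] at h1
  rw [vwpDiff_eliminate hq0 hq ha hb hz, vwpDiff_swap_right, h1,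
    vwpDiff_two_parameters hq0 hq ha hb, vwpDiff_zero hq0 hq ha hb]
  ring

end Bailey

/-! ### Expansion of products of quadratics, and reflection formulas. -/

section Expansion

variable {q : ℂ}

/-- The coefficients of the expansion of `∏ i < n, φ (f q ^ i)` in the products
`∏ i < j, φ (e / q ^ (i + 1))` for a quadratic polynomial `φ` with constant term `1`. -/
def shiftCoeff (q v w : ℂ) (n j : ℕ) : ℂ :=
  qPoch q q n / (qPoch q q j * qPoch q q (n - j)) * qPoch w q (n - j) *
    qPoch (v * q ^ (j + 1)) q (n - j) * v ^ j * q ^ j ^ 2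

theorem shiftCoeff_succ_zero (hq : ‖q‖ < 1) (v w : ℂ) (n : ℕ) :
    shiftCoeff q v w (n + 1) 0 =
      shiftCoeff q v w n 0 * ((1 - v * q ^ (n + 1)) * (1 - w * q ^ n)) := by
  have h1 := qPoch_self_ne_zero hq n
  have h2 := qPoch_self_ne_zero hq (n + 1)
  simp only [shiftCoeff, Nat.sub_zero, qPoch_zero, one_mul, div_self h1, div_self h2]
  rw [qPoch_succ, qPoch_succ]
  ring

theorem shiftCoeff_succ_succ_self (hq : ‖q‖ < 1) (v w : ℂ) (n : ℕ) :
    shiftCoeff q v w (n + 1) (n + 1) = shiftCoeff q v w n n * (v * q ^ (2 * n + 1)) := by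
  have h1 := qPoch_self_ne_zero hq n
  have h2 := qPoch_self_ne_zero hq (n + 1)
  simp only [shiftCoeff, Nat.sub_self, qPoch_zero, mul_one, div_self h1, div_self h2]
  ring

/-- A Pascal-type rule for the interior coefficients. Writing the upper index as `j + 1 + m` avoids
truncated subtraction. -/
theorem shiftCoeff_succ_succ (hq : ‖q‖ < 1) (v w : ℂ) (j m : ℕ) :
    shiftCoeff q v w (j + 1 + m + 1) (j + 1) =
      shiftCoeff q v w (j + 1 + m) (j + 1) *
        ((1 - v * q ^ (j + 1 + m + (j + 1) + 1)) * (1 - w * q ^ m)) +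
      shiftCoeff q v w (j + 1 + m) j * (v * q ^ (j + 1 + m + j + 1)) := by
  have e1 : j + 1 + m + 1 - (j + 1) = m + 1 := by omega
  have e2 : j + 1 + m - (j + 1) = m := by omega
  have e3 : j + 1 + m - j = m + 1 := by omega
  have hj := qPoch_self_ne_zero hq j
  have hj1 := qPoch_self_ne_zero hq (j + 1)
  have hm := qPoch_self_ne_zero hq m
  have hm1 := qPoch_self_ne_zero hq (m + 1)
  simp only [shiftCoeff, e1, e2, e3]
  have h1 : qPoch (v * q ^ (j + 1)) q (m + 1) =
      (1 - v * q ^ (j + 1)) * qPoch (v * q ^ (j + 1 + 1)) q m := by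
    rw [qPoch_succ', mul_assoc v, ← pow_succ]
  rw [h1]
  rw [qPoch_succ] at hj1 hm1
  simp only [qPoch_succ _ _ (j + 1 + m), qPoch_succ _ _ j, qPoch_succ _ _ m]
  have hj2 := right_ne_zero_of_mul hj1
  have hm2 := right_ne_zero_of_mul hm1
  generalize qPoch q q (j + 1 + m) = A
  generalize qPoch (v * q ^ (j + 1 + 1)) q m = B
  generalize qPoch w q m = C
  generalize qPoch q q j = D at *
  generalize qPoch q q m = E at *
  have e4 : q ^ (j + 1) ^ 2 = q ^ j ^ 2 * q ^ j * q ^ j * q := by ring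
  rw [e4]
  simp only [pow_add, pow_one]
  generalize q ^ j ^ 2 = Y
  generalize q ^ j = X at *
  generalize q ^ m = Z at *
  generalize v ^ j = V
  field_simp
  ring

/-- Neither `v = f / e` nor `w = e f s / q` involves `u`, so the coefficients do not either. -/
theorem prod_quadratic_expansion (hq0 : q ≠ 0) (hq : ‖q‖ < 1) {e : ℂ} (he : e ≠ 0) (f u s : ℂ)
    (n : ℕ) :
    ∏ i ∈ Finset.range n, (1 + f * q ^ i * u + (f * q ^ i) ^ 2 * s) =
      ∑ j ∈ Finset.range (n + 1), shiftCoeff q (f / e) (e * f * s / q) n j *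
        ∏ i ∈ Finset.range j, (1 + e / q ^ (i + 1) * u + (e / q ^ (i + 1)) ^ 2 * s) := by
  induction n with
  | zero => simp [shiftCoeff, qPoch]
  | succ n ih =>
    set v := f / e with hv
    set w := e * f * s / q with hw
    set P : ℕ → ℂ := fun j =>
      ∏ i ∈ Finset.range j, (1 + e / q ^ (i + 1) * u + (e / q ^ (i + 1)) ^ 2 * s) with hP
    -- With `φ x = 1 + x u + x² s`, the new factor is `φ (f q^n) = (1 - v q^(n+j+1)) (1 - w q^(n-j))
    -- + v q^(n+j+1) φ (e / q^(j+1))`; the last summand lengthens `P j` to `P (j + 1)`.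
    have key : ∀ j ∈ Finset.range (n + 1), shiftCoeff q v w n j * P j *
        (1 + f * q ^ n * u + (f * q ^ n) ^ 2 * s) =
        shiftCoeff q v w n j * ((1 - v * q ^ (n + j + 1)) * (1 - w * q ^ (n - j))) * P j +
        shiftCoeff q v w n j * (v * q ^ (n + j + 1)) * P (j + 1) := fun j hj => by
      obtain ⟨m, rfl⟩ := Nat.exists_eq_add_of_le (Nat.lt_succ_iff.1 (Finset.mem_range.1 hj))
      have hP1 : P (j + 1) = P j * (1 + e / q ^ (j + 1) * u + (e / q ^ (j + 1)) ^ 2 * s) :=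
        Finset.prod_range_succ _ _
      rw [hP1, Nat.add_sub_cancel_left, hv, hw]
      generalize shiftCoeff q (f / e) (e * f * s / q) (j + m) j = C
      generalize P j = B
      simp only [pow_add, pow_one]
      have hX : q ^ j ≠ 0 := pow_ne_zero _ hq0
      generalize q ^ j = X at *
      generalize q ^ m = Z at *
      field_simp
      ring
    rw [Finset.prod_range_succ, ih, Finset.sum_mul, Finset.sum_congr rfl key,
      Finset.sum_add_distrib, Finset.sum_range_succ', Finset.sum_range_succ _ n,
      Finset.sum_range_succ', Finset.sum_range_succ _ n, shiftCoeff_succ_zero hq,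
      shiftCoeff_succ_succ_self hq]
    have mid : ∑ j ∈ Finset.range n, shiftCoeff q v w (n + 1) (j + 1) * P (j + 1) =
        ∑ j ∈ Finset.range n, shiftCoeff q v w n (j + 1) *
          ((1 - v * q ^ (n + (j + 1) + 1)) * (1 - w * q ^ (n - (j + 1)))) * P (j + 1) +
        ∑ j ∈ Finset.range n, shiftCoeff q v w n j * (v * q ^ (n + j + 1)) * P (j + 1) := by
      rw [← Finset.sum_add_distrib]
      refine Finset.sum_congr rfl fun j hj => ?_
      obtain ⟨m, rfl⟩ := Nat.exists_eq_add_of_le (Nat.succ_le_of_lt (Finset.mem_range.1 hj))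
      rw [Nat.succ_eq_add_one, shiftCoeff_succ_succ hq, Nat.add_sub_cancel_left]
      ring
    rw [mid]
    simp only [Nat.sub_zero, add_zero]
    ring

/-- The reflection of a finite `q`-shifted factorial. -/
theorem qPoch_div_pow (hq0 : q ≠ 0) {x : ℂ} (hx : x ≠ 0) (j : ℕ) :
    qPoch (x / q ^ j) q j =
      (-x) ^ j / (∏ i ∈ Finset.range j, q ^ (i + 1)) * qPoch (q / x) q j := by
  rw [qPoch, qPoch, ← Finset.prod_range_reflect]
  conv_rhs => rw [← Finset.card_range j, ← Finset.prod_const, Finset.card_range,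
    ← Finset.prod_div_distrib, ← Finset.prod_mul_distrib]
  refine Finset.prod_congr rfl fun i hi => ?_
  obtain ⟨m, rfl⟩ := Nat.exists_eq_add_of_le (Nat.succ_le_of_lt (Finset.mem_range.1 hi))
  rw [show i.succ + m - 1 - i = m by omega, Nat.succ_eq_add_one]
  simp only [pow_add, pow_one]
  field_simp
  ring

/-- Squaring doubles the exponent `j (j + 1) / 2` and avoids the division. -/
theorem sq_prod_pow_succ (q : ℂ) (j : ℕ) :
    (∏ i ∈ Finset.range j, q ^ (i + 1)) ^ 2 = q ^ j ^ 2 * q ^ j := by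
  induction j with
  | zero => simp
  | succ j ih =>
    rw [Finset.prod_range_succ, mul_pow, ih]
    ring

theorem qPochInf_div_pow (hq0 : q ≠ 0) (hq : ‖q‖ < 1) {x : ℂ} (hx : x ≠ 0) (j : ℕ) :
    qPochInf (x / q ^ j) q = (-x) ^ j / (∏ i ∈ Finset.range j, q ^ (i + 1)) *
      qPoch (q / x) q j * qPochInf x q := by
  rw [← qPoch_div_pow hq0 hx, ← qPoch_mul_qPochInf hq (x / q ^ j) j,
    div_mul_cancel₀ x (pow_ne_zero j hq0)]

/-- The factorials of length `n - j` are turned into factorials of length `j` by reflection. The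
reflection constants of `(q; q)_n` and `(w; q)_n` cancel up to `(q / w)^j`. -/
theorem shiftCoeff_eq (hq0 : q ≠ 0) (hq : ‖q‖ < 1) {v w : ℂ} (hw : w ≠ 0) {n j : ℕ}
    (hjn : j ≤ n) (h1 : qPoch (q / (w * q ^ n)) q j ≠ 0) (h2 : qPoch (q * v) q j ≠ 0) :
    shiftCoeff q v w n j = qPoch w q n * qPoch (q * v) q n *
      (qPoch (1 / q ^ n) q j * q ^ j /
        (qPoch q q j * qPoch (q / (w * q ^ n)) q j * qPoch (q * v) q j)) *
      (v / w) ^ j * q ^ j ^ 2 := by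
  obtain ⟨m, rfl⟩ := Nat.exists_eq_add_of_le hjn
  have hg : ∏ i ∈ Finset.range j, q ^ (i + 1) ≠ 0 :=
    Finset.prod_ne_zero_iff.2 fun i _ => pow_ne_zero _ hq0
  have hw1 : w * q ^ (j + m) ≠ 0 := mul_ne_zero hw (pow_ne_zero _ hq0)
  have hv : qPoch (q * v) q (j + m) = qPoch (q * v) q j * qPoch (v * q ^ (j + 1)) q m := by
    rw [qPoch_add]; congr 2; ring
  have e1 : w * q ^ (j + m) / q ^ j = w * q ^ m := by
    rw [pow_add]; field_simp
  have hwn : qPoch w q (j + m) = qPoch w q m *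
      ((-(w * q ^ (j + m))) ^ j / (∏ i ∈ Finset.range j, q ^ (i + 1)) *
        qPoch (q / (w * q ^ (j + m))) q j) := by
    rw [← qPoch_div_pow hq0 hw1, add_comm j m, qPoch_add, add_comm m j, e1]
  have e2 : q ^ (j + m + 1) / q ^ j = q * q ^ m := by
    rw [pow_succ, pow_add]; field_simp
  have hqn : qPoch q q (j + m) = qPoch q q m *
      ((-(q ^ (j + m + 1))) ^ j / (∏ i ∈ Finset.range j, q ^ (i + 1)) *
        qPoch (1 / q ^ (j + m)) q j) := by
    rw [show 1 / q ^ (j + m) = q / q ^ (j + m + 1) by rw [pow_succ]; field_simp,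
      ← qPoch_div_pow hq0 (pow_ne_zero _ hq0), add_comm j m, qPoch_add, add_comm m j, e2]
  have hj := qPoch_self_ne_zero hq j
  have hm := qPoch_self_ne_zero hq m
  rw [shiftCoeff, Nat.add_sub_cancel_left, hv, hwn, hqn]
  rw [show -(q ^ (j + m + 1)) = -(q ^ (j + m)) * q by ring,
    show -(w * q ^ (j + m)) = -(q ^ (j + m)) * w by ring, mul_pow, mul_pow, div_pow]
  generalize qPoch (q / (w * q ^ (j + m))) q j = A at h1 ⊢
  generalize qPoch (q * v) q j = B at h2 ⊢
  field_simp

end Expansion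

/-! ### Reduction of the series for `ρ'` to bilateral series. -/

section Reciprocity

variable {q a b : ℂ}

theorem qPochList_cons (x : ℂ) (l : List ℂ) (q : ℂ) (n : ℕ) :
    qPochList (x :: l) q n = qPoch x q n * qPochList l q n := by simp [qPochList]

theorem qPochList_nil (q : ℂ) (n : ℕ) : qPochList [] q n = 1 := by simp [qPochList]

theorem qPochInfList_cons (x : ℂ) (l : List ℂ) (q : ℂ) :
    qPochInfList (x :: l) q = qPochInf x q * qPochInfList l q := by simp [qPochInfList]

theorem qPochInfList_nil (q : ℂ) : qPochInfList [] q = 1 := by simp [qPochInfList]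

theorem vwpFactor_div_pow (hq0 : q ≠ 0) (hq : ‖q‖ < 1) (ha : a ≠ 0) (x : ℂ) (k j : ℕ) :
    vwpFactor q a b (x / q ^ j) k = vwpFactor q a b x k *
      ∏ i ∈ Finset.range j, vwpShift q a b (x / q ^ (i + 1)) k := by
  induction j with
  | zero => simp
  | succ j ih =>
    rw [vwpFactor_eq_mul_shift hq0 hq ha, Finset.prod_range_succ, ← mul_assoc, ← ih,
      show x / q ^ (j + 1) * q = x / q ^ j by rw [pow_succ]; field_simp]

theorem vwpTerm_div_pow (hq0 : q ≠ 0) (hq : ‖q‖ < 1) (ha : a ≠ 0) (c d h x : ℂ) (k j : ℕ) :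
    vwpTerm q a b c d h (x / q ^ j) k = vwpTerm q a b c d h x k *
      ∏ i ∈ Finset.range j, vwpShift q a b (x / q ^ (i + 1)) k := by
  simp only [vwpTerm, vwpKernel, vwpFactor_div_pow hq0 hq ha x]
  ring

/-- Only the linear coefficient depends on `k`; the quadratic one is also symmetric in `a, b`. -/
theorem vwpShift_eq (hq0 : q ≠ 0) (ha : a ≠ 0) (x : ℂ) (k : ℕ) :
    vwpShift q a b x k =
      1 + x * (q ^ (k + 1) / b + 1 / (a * q ^ k)) + x ^ 2 * (q / (a * b)) := by
  rw [vwpShift, pow_succ]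
  field_simp
  ring

theorem vwpTerm_mul_prod_shift (hq0 : q ≠ 0) (hq : ‖q‖ < 1) (ha : a ≠ 0)
    {e : ℂ} (he : e ≠ 0) (c d f h : ℂ) (n k : ℕ) :
    vwpTerm q a b c d h e k * ∏ i ∈ Finset.range n, vwpShift q a b (f * q ^ i) k =
      ∑ j ∈ Finset.range (n + 1), shiftCoeff q (f / e) (e * f / (a * b)) n j *
        vwpTerm q a b c d h (e / q ^ j) k := by
  simp only [vwpTerm_div_pow hq0 hq ha, vwpShift_eq hq0 ha]
  rw [prod_quadratic_expansion hq0 hq he, Finset.mul_sum,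
    show e * f * (q / (a * b)) / q = e * f / (a * b) by field_simp]
  exact Finset.sum_congr rfl fun j _ => by ring

theorem qPoch_div_qPoch_eq_vwpFactor (hq : ‖q‖ < 1) {x : ℂ} (hx : x ≠ 0)
    (h1 : qPochInf (-x / a) q ≠ 0) (h2 : qPochInf (-x / b) q ≠ 0) (k : ℕ) :
    qPoch (-q * a / x) q k / qPoch (-x / b) q (k + 1) * x ^ k =
      vwpFactor q a b x k / (qPochInf (-x / b) q * qPochInf (-x / a) q) := by
  have h3 := qPoch_mul_qPochInf hq (-x / b) (k + 1)
  rw [show -x / b * q ^ (k + 1) = -x * q ^ (k + 1) / b by ring] at h3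
  have h4 : ∏ i ∈ Finset.range k, (x + a * q ^ (i + 1)) = qPoch (-q * a / x) q k * x ^ k := by
    conv_rhs => rw [← Finset.card_range k, ← Finset.prod_const, Finset.card_range, qPoch,
      ← Finset.prod_mul_distrib]
    refine Finset.prod_congr rfl fun i _ => ?_
    field_simp
    ring
  rw [← h3] at h2 ⊢
  have h5 := left_ne_zero_of_mul h2
  have h6 := right_ne_zero_of_mul h2
  rw [vwpFactor, h4]
  generalize qPoch (-x / b) q (k + 1) = A at *
  generalize qPochInf (-x * q ^ (k + 1) / b) q = B at *
  generalize qPochInf (-x / a) q = C at *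
  generalize qPoch (-q * a / x) q k = D
  field_simp

/-- This is the parameter `x = a b`. The factors `1 + 1/b` and `1 + b` are matched without dividing
by `1 + b`, so `b = -1` is allowed; the quotient of the two is the extra `b` in the denominator. -/
theorem qPoch_div_qPoch_eq_vwpFactor_mul (hq : ‖q‖ < 1) (ha : a ≠ 0) (hb : b ≠ 0)
    (h1 : qPochInf (-q * a) q ≠ 0) (h2 : qPochInf (-q * b) q ≠ 0) (k : ℕ) :
    qPoch (-1 / b) q (k + 1) / qPoch (-q * a) q k * (a * b) ^ k =
      vwpFactor q a b (a * b) k / (b * (qPochInf (-q * a) q * qPochInf (-q * b) q)) := by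
  have h3 := qPoch_mul_qPochInf hq (-q * a) k
  have h4 : ∏ i ∈ Finset.range k, (a * b + a * q ^ (i + 1)) =
      qPoch (-1 / b * q) q k * (a * b) ^ k := by
    conv_rhs => rw [← Finset.card_range k, ← Finset.prod_const, Finset.card_range, qPoch,
      ← Finset.prod_mul_distrib]
    refine Finset.prod_congr rfl fun i _ => ?_
    field_simp
    ring
  have h7 := qPochInf_eq_mul hq (-b)
  rw [show -b * q = -q * b by ring] at h7
  rw [← h3] at h1 ⊢
  have h5 := left_ne_zero_of_mul h1
  have h6 := right_ne_zero_of_mul h1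
  rw [vwpFactor, h4, show -(a * b) * q ^ (k + 1) / b = -q * a * q ^ k by field_simp; ring,
    show -(a * b) / a = -b by field_simp, h7, qPoch_succ']
  generalize qPoch (-q * a) q k = A at *
  generalize qPochInf (-q * a * q ^ k) q = B at *
  generalize qPochInf (-q * b) q = C at *
  generalize qPoch (-1 / b * q) q k = D
  field_simp
  ring

theorem qPoch_pair_eq_prod_shift (hq0 : q ≠ 0) (ha : a ≠ 0) {f : ℂ} (hf : f ≠ 0)
    (n k : ℕ) (h1 : qPoch (-f / b) q (k + 1) ≠ 0) (h2 : qPoch (-a / (f * q ^ n)) q (k + 1) ≠ 0)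
    (h3 : qPoch (-f / a) q (n + 1) ≠ 0) (h4 : qPoch (-f / b) q (n + 1) ≠ 0) :
    qPoch (-q * a / f) q k * qPoch (-q ^ (1 + n) * f / b) q k /
        (qPoch (-f / b) q (k + 1) * qPoch (-a / (f * q ^ n)) q (k + 1)) * (1 / q ^ n) ^ k =
      f * q ^ n / a * (∏ i ∈ Finset.range n, vwpShift q a b (f * q ^ i) k) /
        (qPoch (-f / a) q (n + 1) * qPoch (-f / b) q (n + 1)) := by
  have hX : q ^ k ≠ 0 := pow_ne_zero _ hq0
  have hN : q ^ n ≠ 0 := pow_ne_zero _ hq0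
  -- In `e1` and `e2` a factorial of length `n + k + 1` is cut at two different places. This trades
  -- quotients of length `k` for factorials of length `n`.
  have e1 : qPoch (-f / b) q (k + 1) * qPoch (-f * q ^ (k + 1) / b) q n =
      qPoch (-f / b) q (n + 1) * qPoch (-q ^ (1 + n) * f / b) q k := by
    rw [show -f * q ^ (k + 1) / b = -f / b * q ^ (k + 1) by ring,
      show -q ^ (1 + n) * f / b = -f / b * q ^ (n + 1) by ring, ← qPoch_add, ← qPoch_add]
    congr 1; omega
  have e2 : qPoch (-a / (f * q ^ n)) q (k + 1) * qPoch (-a * q ^ k * q / f / q ^ n) q n =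
      qPoch (-a * q / f / q ^ (n + 1)) q (n + 1) * qPoch (-q * a / f) q k := by
    have i1 : -a * q ^ k * q / f / q ^ n = -a / (f * q ^ n) * q ^ (k + 1) := by
      field_simp; ring
    have i2 : -a * q / f / q ^ (n + 1) = -a / (f * q ^ n) := by
      rw [pow_succ]; field_simp
    have i3 : -q * a / f = -a / (f * q ^ n) * q ^ (n + 1) := by
      rw [pow_succ]; field_simp
    rw [i1, i2, i3, ← qPoch_add, ← qPoch_add]
    congr 1; omega
  have e3 := qPoch_div_pow hq0 (x := -a * q / f)
    (div_ne_zero (mul_ne_zero (neg_ne_zero.2 ha) hq0) hf) (n + 1)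
  have e4 := qPoch_div_pow hq0 (x := -a * q ^ k * q / f)
    (div_ne_zero (mul_ne_zero (mul_ne_zero (neg_ne_zero.2 ha) hX) hq0) hf) n
  rw [show q / (-a * q / f) = -f / a by field_simp] at e3
  rw [show q / (-a * q ^ k * q / f) = -f / (a * q ^ k) by field_simp] at e4
  have e5 : ∏ i ∈ Finset.range n, vwpShift q a b (f * q ^ i) k =
      qPoch (-f * q ^ (k + 1) / b) q n * qPoch (-f / (a * q ^ k)) q n := by
    rw [qPoch, qPoch, ← Finset.prod_mul_distrib]
    refine Finset.prod_congr rfl fun i _ => ?_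
    rw [vwpShift]
    ring
  have hg : ∏ i ∈ Finset.range n, q ^ (i + 1) ≠ 0 :=
    Finset.prod_ne_zero_iff.2 fun i _ => pow_ne_zero _ hq0
  rw [e3, e4, Finset.prod_range_succ] at e2
  have e6 : q ^ n * f * (qPoch (-a / (f * q ^ n)) q (k + 1) * (q ^ k) ^ n *
      qPoch (-f / (a * q ^ k)) q n) = a *
      (qPoch (-f / a) q (n + 1) * qPoch (-q * a / f) q k) := by
    have hne : (a * q / f) ^ n ≠ 0 := pow_ne_zero _ (div_ne_zero (mul_ne_zero ha hq0) hf)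
    rw [show -(-a * q ^ k * q / f) = a * q / f * q ^ k by ring,
      show -(-a * q / f) = a * q / f by ring, mul_pow, pow_succ (a * q / f)] at e2
    generalize (a * q / f) ^ n = W at *
    rw [pow_succ q n] at e2
    field_simp at e2 ⊢
    linear_combination e2
  rw [e5]
  have hp : (1 / q ^ n) ^ k = 1 / (q ^ k) ^ n := by
    rw [div_pow, one_pow, ← pow_mul, ← pow_mul, mul_comm]
  rw [hp]
  have hXn : (q ^ k) ^ n ≠ 0 := pow_ne_zero _ hX
  generalize (q ^ k) ^ n = U at *
  generalize qPoch (-f / (a * q ^ k)) q n = P1 at *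
  generalize qPoch (-f * q ^ (k + 1) / b) q n = P2 at *
  generalize qPoch (-q * a / f) q k = P3 at *
  generalize qPoch (-q ^ (1 + n) * f / b) q k = P4 at *
  generalize qPoch (-a / (f * q ^ n)) q (k + 1) = P5 at *
  generalize qPoch (-f / b) q (k + 1) = P6 at *
  generalize qPoch (-f / b) q (n + 1) = P7 at *
  generalize qPoch (-f / a) q (n + 1) = P8 at *
  field_simp
  linear_combination (-P3 * P8 * a) * e1 - P6 * P2 * e6

/-- The constant relating the terms of `rhoPrime` and the normalised very-well-poised terms. -/
def rhoConst (q a b c d e f : ℂ) (n : ℕ) : ℂ :=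
  f * q ^ n / (a * b) / (qPoch (-f / a) q (n + 1) * qPoch (-f / b) q (n + 1) *
    (qPochInf (-q * a) q * qPochInf (-q * b) q) *
    (qPochInf (-c / b) q * qPochInf (-c / a) q) * (qPochInf (-d / b) q * qPochInf (-d / a) q) *
    (qPochInf (-e / b) q * qPochInf (-e / a) q))

theorem rhoConst_swap (q a b c d e f : ℂ) (n : ℕ) :
    rhoConst q b a c d e f n = rhoConst q a b c d e f n := by
  simp only [rhoConst, mul_comm, mul_left_comm]

theorem rhoTerm_eq {c d e f : ℂ} (hq0 : q ≠ 0) (hq : ‖q‖ < 1) (ha : a ≠ 0) (hb : b ≠ 0)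
    (hc : c ≠ 0) (hd : d ≠ 0) (he : e ≠ 0) (hf : f ≠ 0) (n k : ℕ)
    (hqa : qPochInf (-q * a) q ≠ 0) (hqb : qPochInf (-q * b) q ≠ 0)
    (hca : qPochInf (-c / a) q ≠ 0) (hcb : qPochInf (-c / b) q ≠ 0)
    (hda : qPochInf (-d / a) q ≠ 0) (hdb : qPochInf (-d / b) q ≠ 0)
    (hea : qPochInf (-e / a) q ≠ 0) (heb : qPochInf (-e / b) q ≠ 0)
    (hfa : ∀ k, qPoch (-f / a) q (k + 1) ≠ 0) (hfb : ∀ k, qPoch (-f / b) q (k + 1) ≠ 0)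
    (haf : qPoch (-a / (f * q ^ n)) q (k + 1) ≠ 0) :
    rhoTerm q a b c d e f n k = rhoConst q a b c d e f n *
      ∑ j ∈ Finset.range (n + 1), shiftCoeff q (f / e) (e * f / (a * b)) n j *
        vwpTerm q a b c d (a * b) (e / q ^ j) k := by
  have tc := qPoch_div_qPoch_eq_vwpFactor hq hc hca hcb k
  have td := qPoch_div_qPoch_eq_vwpFactor hq hd hda hdb k
  have te := qPoch_div_qPoch_eq_vwpFactor hq he hea heb k
  have th := qPoch_div_qPoch_eq_vwpFactor_mul hq ha hb hqa hqb k
  have tf := qPoch_pair_eq_prod_shift hq0 ha hf n k (hfb k) haf (hfa n) (hfb n)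
  -- Each parameter, including `a b`, receives its own `k`-th power; the `f` pair takes `1 / q ^ n`.
  have hz : (c * d * e / (a * b * q ^ (n + 1))) ^ k =
      c ^ k * d ^ k * e ^ k * (a * b) ^ k * (1 / q ^ n) ^ k / (a ^ 2 * b ^ 2 * q) ^ k := by
    rw [← mul_pow, ← mul_pow, ← mul_pow, ← mul_pow, ← div_pow, pow_succ]
    congr 1
    field_simp
  rw [← vwpTerm_mul_prod_shift hq0 hq ha he]
  calc rhoTerm q a b c d e f n k = (1 - a * q ^ (2 * k + 1) / b) *
        (qPoch (-1 / b) q (k + 1) / qPoch (-q * a) q k * (a * b) ^ k) *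
        (qPoch (-q * a / c) q k / qPoch (-c / b) q (k + 1) * c ^ k) *
        (qPoch (-q * a / d) q k / qPoch (-d / b) q (k + 1) * d ^ k) *
        (qPoch (-q * a / e) q k / qPoch (-e / b) q (k + 1) * e ^ k) *
        (qPoch (-q * a / f) q k * qPoch (-q ^ (1 + n) * f / b) q k /
          (qPoch (-f / b) q (k + 1) * qPoch (-a / (f * q ^ n)) q (k + 1)) * (1 / q ^ n) ^ k) /
        (a ^ 2 * b ^ 2 * q) ^ k := by
        rw [rhoTerm, hz]
        simp only [qPochList_cons, qPochList_nil, div_eq_mul_inv, mul_inv]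
        ring
    _ = _ := by
        rw [tc, td, te, th, tf, vwpTerm, vwpKernel, rhoConst]
        simp only [div_eq_mul_inv, mul_inv]
        ring

/-- Bailey's sum with the parameter `e` divided by `q ^ j`, relative to its value at `j = 0`. -/
theorem vwpDiff_div_pow {c d e : ℂ} (hq0 : q ≠ 0) (hq : ‖q‖ < 1) (ha : a ≠ 0) (hb : b ≠ 0)
    (hc : c ≠ 0) (hd : d ≠ 0) (he : e ≠ 0) (j : ℕ)
    (hz : ‖c * d * e / (q * a * b) / q ^ j‖ < 1) :
    vwpDiff q a b c d (a * b) (e / q ^ j) =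
      (1 / b - 1 / a) * (qPochInf q q * qPochInf (q * a / b) q * qPochInf (q * b / a) q) *
      (qPochInf c q * qPochInf d q * qPochInf e q * qPochInf (c * d / (a * b)) q *
        qPochInf (c * e / (a * b)) q * qPochInf (d * e / (a * b)) q) /
        qPochInf (c * d * e / (q * a * b)) q *
      (qPoch (q / e) q j * qPoch (q * a * b / (c * e)) q j * qPoch (q * a * b / (d * e)) q j /
        qPoch (q ^ 2 * a * b / (c * d * e)) q j) *
      (e ^ 2 / (a * b)) ^ j / q ^ j ^ 2 := by
  have hX : q ^ j ≠ 0 := pow_ne_zero _ hq0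
  have h1 : c * d * (a * b) * (e / q ^ j) / (a ^ 2 * b ^ 2 * q) =
      c * d * e / (q * a * b) / q ^ j := by field_simp
  have h := vwpDiff_eq hq0 hq ha hb (c := c) (d := d) (e := a * b) (h := e / q ^ j) (h1 ▸ hz)
  rw [h1, show c * (e / q ^ j) / (a * b) = c * e / (a * b) / q ^ j by ring,
    show d * (e / q ^ j) / (a * b) = d * e / (a * b) / q ^ j by ring,
    show a * b * (e / q ^ j) / (a * b) = e / q ^ j by field_simp,
    show c * (a * b) / (a * b) = c by field_simp, show d * (a * b) / (a * b) = d by field_simp] at h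
  -- Convergence at `e / q^j` makes this product nonzero. After reflection it contains `(q² a b / (c
  -- d e); q)_j`, so that denominator of the `₄φ₃` needs no separate hypothesis.
  have hZ : qPochInf (c * d * e / (q * a * b) / q ^ j) q ≠ 0 :=
    qPochInf_ne_zero_of_norm_lt_one hq hz
  rw [qPochInf_div_pow hq0 hq (x := c * d * e / (q * a * b)) (by positivity)] at h hZ
  rw [qPochInf_div_pow hq0 hq (x := c * e / (a * b)) (by positivity),
    qPochInf_div_pow hq0 hq (x := d * e / (a * b)) (by positivity),
    qPochInf_div_pow hq0 hq he] at h
  rw [show q / (c * e / (a * b)) = q * a * b / (c * e) by field_simp,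
    show q / (d * e / (a * b)) = q * a * b / (d * e) by field_simp] at h
  rw [show q / (c * d * e / (q * a * b)) = q ^ 2 * a * b / (c * d * e) by field_simp] at h hZ
  have hg : ∏ i ∈ Finset.range j, q ^ (i + 1) ≠ 0 :=
    Finset.prod_ne_zero_iff.2 fun i _ => pow_ne_zero _ hq0
  -- Three reflections in the numerator against one in the denominator leave `1 / g²`, whence the
  -- factor `1 / q^(j²)`.
  have hg2 := sq_prod_pow_succ q j
  have hz1 := right_ne_zero_of_mul hZ
  have hz2 := right_ne_zero_of_mul (left_ne_zero_of_mul hZ)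
  have hY : q ^ j ^ 2 ≠ 0 := pow_ne_zero _ hq0
  have hpow : (-(c * e / (a * b))) ^ j * (-(d * e / (a * b))) ^ j * (-e) ^ j =
      (-(c * d * e / (q * a * b))) ^ j * (e ^ 2 / (a * b)) ^ j * q ^ j := by
    rw [← mul_pow, ← mul_pow, ← mul_pow, ← mul_pow]
    congr 1
    field_simp
  have hpz : (-(c * d * e / (q * a * b))) ^ j ≠ 0 :=
    pow_ne_zero _ (neg_ne_zero.2 (by positivity))
  refine mul_left_cancel₀ hZ (h.trans ?_)
  generalize ∏ i ∈ Finset.range j, q ^ (i + 1) = g at *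
  generalize (-(c * e / (a * b))) ^ j = p1 at *
  generalize (-(d * e / (a * b))) ^ j = p2 at *
  generalize (-e) ^ j = p3 at *
  generalize (-(c * d * e / (q * a * b))) ^ j = p4 at *
  generalize (e ^ 2 / (a * b)) ^ j = p5 at *
  generalize qPochInf (c * d * e / (q * a * b)) q = Z1 at *
  generalize qPoch (q ^ 2 * a * b / (c * d * e)) q j = Z2 at *
  generalize (1 / b - 1 / a) * (qPochInf q q * qPochInf (q * a / b) q * qPochInf (q * b / a) q) = J
  generalize qPochInf (c * e / (a * b)) q = Q1
  generalize qPochInf (d * e / (a * b)) q = Q2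
  generalize qPochInf (c * d / (a * b)) q = Q3
  generalize qPoch (q / e) q j = R1
  generalize qPoch (q * a * b / (c * e)) q j = R2
  generalize qPoch (q * a * b / (d * e)) q j = R3
  generalize q ^ j ^ 2 = Y at *
  generalize q ^ j = X at *
  have hYX : g ^ 2 = Y * X := hg2
  have : p1 / g * (p2 / g) * (p3 / g) = p4 / g * p5 / Y := by
    field_simp
    rw [hpow, hYX]
    ring
  calc _ = p1 / g * (p2 / g) * (p3 / g) * (J * (R1 * R2 * R3 * Q1 * Q2 * Q3 * qPochInf e q *
        qPochInf c q * qPochInf d q)) := by ring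
    _ = p4 / g * p5 / Y * (J * (R1 * R2 * R3 * Q1 * Q2 * Q3 * qPochInf e q *
        qPochInf c q * qPochInf d q)) * (Z1 / Z1) * (Z2 / Z2) := by
      rw [this, div_self hz1, div_self hz2, mul_one, mul_one]
    _ = _ := by ring

/-- For `j > n` the numerator vanishes, so the term is `0` even where a denominator is `0`, as
division by zero gives `0`. -/
theorem basicHyp_four_three_terminating (hq0 : q ≠ 0) (n : ℕ) (x y z u v w : ℂ) :
    basicHyp [q ^ (-(n : ℤ)), x, y, z] [u, v, w] q q =
      ∑ j ∈ Finset.range (n + 1), qPoch (1 / q ^ n) q j *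
        (qPoch x q j * qPoch y q j * qPoch z q j) /
        (qPoch q q j * (qPoch u q j * qPoch v q j * qPoch w q j)) * q ^ j := by
  have hqn : q ^ (-(n : ℤ)) = 1 / q ^ n := by rw [zpow_neg, zpow_natCast, one_div]
  rw [basicHyp, hqn, tsum_eq_sum (s := Finset.range (n + 1))]
  · refine Finset.sum_congr rfl fun j _ => ?_
    simp [qPochList_cons, qPochList_nil, mul_assoc]
  · intro j hj
    have : qPoch (1 / q ^ n) q j = 0 :=
      Finset.prod_eq_zero (i := n) (Finset.mem_range.2 (by simpa using hj))
        (by rw [one_div_mul_cancel (pow_ne_zero _ hq0), sub_self])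
    rw [qPochList_cons, this]
    simp

theorem qPoch_ne_zero_of_le {x : ℂ} {j n : ℕ} (hjn : j ≤ n) (h : qPoch x q n ≠ 0) :
    qPoch x q j ≠ 0 := by
  obtain ⟨m, rfl⟩ := Nat.exists_eq_add_of_le hjn
  rw [qPoch_add] at h
  exact left_ne_zero_of_mul h

theorem qPochInf_ne_zero_of_qPoch_succ (hq : ‖q‖ < 1) {x : ℂ}
    (h : ∀ k : ℕ, qPoch x q (k + 1) ≠ 0) : qPochInf x q ≠ 0 :=
  qPochInf_ne_zero_of_qPoch hq fun k => qPoch_ne_zero_of_le k.le_succ (h k)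

end Reciprocity

end

/-! ### The reciprocity theorem. -/

theorem corollary2p3 (q a b c d e f : ℂ) (n : ℕ)
    (hq0 : q ≠ 0) (hq1 : ‖q‖ < 1)
    (ha : a ≠ 0) (hb : b ≠ 0) (hc : c ≠ 0) (hd : d ≠ 0) (he : e ≠ 0) (hf : f ≠ 0)
    (hconv : ‖c * d * e / (a * b * q ^ (n + 1))‖ < 1)
    -- no denominator of the two series on the left vanishes
    (hden_ab : ∀ k : ℕ, qPoch (-q * a) q k ≠ 0 ∧
      qPochList [-c / b, -d / b, -e / b, -f / b, -a / (f * q ^ n)] q (k + 1) ≠ 0)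
    (hden_ba : ∀ k : ℕ, qPoch (-q * b) q k ≠ 0 ∧
      qPochList [-c / a, -d / a, -e / a, -f / a, -b / (f * q ^ n)] q (k + 1) ≠ 0)
    -- no denominator of the terminating series on the right vanishes
    (hden_phi : qPochList [q ^ (1 - (n : ℤ)) * a * b / (e * f), q * f / e] q n ≠ 0) :
    Summable (rhoTerm q a b c d e f n) ∧ Summable (rhoTerm q b a c d e f n) ∧
    rhoPrime q a b c d e f n - rhoPrime q b a c d e f n =
      (1 / b - 1 / a) *
        (qPochInfList [q, q * a / b, q * b / a, c, d, e, c * d / (a * b), c * e / (a * b),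
            d * e / (a * b)] q /
          qPochInfList [-q * a, -q * b, -c / a, -c / b, -d / a, -d / b, -e / a, -e / b,
            c * d * e / (q * a * b)] q) *
        (f * q ^ n / (a * b)) *
        (qPochList [q * f / e, e * f / (a * b)] q n /
          qPochList [-f / a, -f / b] q (n + 1)) *
        basicHyp [q ^ (-(n : ℤ)), q / e, q * a * b / (c * e), q * a * b / (d * e)]
          [q ^ (1 - (n : ℤ)) * a * b / (e * f), q * f / e, q ^ 2 * a * b / (c * d * e)] q q := by
  simp only [qPochList_cons, qPochList_nil, mul_one, mul_ne_zero_iff] at hden_ab hden_ba hden_phi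
  have hqa := qPochInf_ne_zero_of_qPoch hq1 fun k => (hden_ab k).1
  have hqb := qPochInf_ne_zero_of_qPoch hq1 fun k => (hden_ba k).1
  have hcb := qPochInf_ne_zero_of_qPoch_succ hq1 fun k => (hden_ab k).2.1
  have hca := qPochInf_ne_zero_of_qPoch_succ hq1 fun k => (hden_ba k).2.1
  have hdb := qPochInf_ne_zero_of_qPoch_succ hq1 fun k => (hden_ab k).2.2.1
  have hda := qPochInf_ne_zero_of_qPoch_succ hq1 fun k => (hden_ba k).2.2.1
  have heb := qPochInf_ne_zero_of_qPoch_succ hq1 fun k => (hden_ab k).2.2.2.1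
  have hea := qPochInf_ne_zero_of_qPoch_succ hq1 fun k => (hden_ba k).2.2.2.1
  have hfb := fun k => (hden_ab k).2.2.2.2.1
  have hfa := fun k => (hden_ba k).2.2.2.2.1
  have tab := fun k => rhoTerm_eq hq0 hq1 ha hb hc hd he hf n k hqa hqb hca hcb hda hdb hea heb
    hfa hfb (hden_ab k).2.2.2.2.2
  have tba := fun k => rhoTerm_eq hq0 hq1 hb ha hc hd he hf n k hqb hqa hcb hca hdb hda heb hea
    hfb hfa (hden_ba k).2.2.2.2.2
  -- The hypothesis is the extreme case `j = n`; smaller `j` gain a power of `q`.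
  have hz : ∀ j ∈ Finset.range (n + 1), ‖c * d * e / (q * a * b) / q ^ j‖ < 1 := fun j hj => by
    obtain ⟨m, rfl⟩ := Nat.exists_eq_add_of_le (Nat.lt_succ_iff.1 (Finset.mem_range.1 hj))
    rw [show c * d * e / (q * a * b) / q ^ j =
      c * d * e / (a * b * q ^ (j + m + 1)) * q ^ m by
        rw [pow_succ, pow_add]; field_simp]
    exact norm_mul_mul_pow_lt_one hq1 hconv m
  have sab : ∀ j ∈ Finset.range (n + 1), Summable (vwpTerm q a b c d (a * b) (e / q ^ j)) :=
    fun j hj => summable_vwpTerm hq0 hq1 ha hb (by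
      convert! hz j hj using 2
      field_simp)
  have sba : ∀ j ∈ Finset.range (n + 1), Summable (vwpTerm q b a c d (a * b) (e / q ^ j)) :=
    fun j hj => summable_vwpTerm hq0 hq1 hb ha (by
      convert! hz j hj using 2
      field_simp)
  have Hab := (hasSum_sum fun j hj => ((sab j hj).hasSum.mul_left
    (shiftCoeff q (f / e) (e * f / (a * b)) n j))).mul_left (rhoConst q a b c d e f n)
  have Hba := (hasSum_sum fun j hj => ((sba j hj).hasSum.mul_left
    (shiftCoeff q (f / e) (e * f / (a * b)) n j))).mul_left (rhoConst q a b c d e f n)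
  rw [← funext tab] at Hab
  -- The constant and the coefficients are symmetric in `a, b`, so both halves are expanded with the
  -- same weights and can be paired for each `j`.
  simp only [rhoConst_swap q a b, mul_comm b a] at tba
  rw [← funext tba] at Hba
  refine ⟨Hab.summable, Hba.summable, ?_⟩
  have hq1n : q ^ (1 - (n : ℤ)) * a * b / (e * f) = q / (e * f / (a * b) * q ^ n) := by
    rw [zpow_sub₀ hq0, zpow_one, zpow_natCast]
    field_simp
  rw [hq1n] at hden_phi ⊢
  have hqv : q * f / e = q * (f / e) := by ring
  rw [hqv] at hden_phi ⊢
  have key : ∀ j ∈ Finset.range (n + 1), shiftCoeff q (f / e) (e * f / (a * b)) n j *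
      vwpDiff q a b c d (a * b) (e / q ^ j) =
      (1 / b - 1 / a) * (qPochInf q q * qPochInf (q * a / b) q * qPochInf (q * b / a) q) *
      (qPochInf c q * qPochInf d q * qPochInf e q * qPochInf (c * d / (a * b)) q *
        qPochInf (c * e / (a * b)) q * qPochInf (d * e / (a * b)) q) /
        qPochInf (c * d * e / (q * a * b)) q *
      (qPoch (q * (f / e)) q n * qPoch (e * f / (a * b)) q n) *
      (qPoch (1 / q ^ n) q j *
        (qPoch (q / e) q j * qPoch (q * a * b / (c * e)) q j * qPoch (q * a * b / (d * e)) q j) /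
        (qPoch q q j * (qPoch (q / (e * f / (a * b) * q ^ n)) q j * qPoch (q * (f / e)) q j *
          qPoch (q ^ 2 * a * b / (c * d * e)) q j)) * q ^ j) := fun j hj => by
    have hjn := Nat.lt_succ_iff.1 (Finset.mem_range.1 hj)
    rw [shiftCoeff_eq hq0 hq1 (by positivity) hjn (qPoch_ne_zero_of_le hjn hden_phi.1)
      (qPoch_ne_zero_of_le hjn hden_phi.2), vwpDiff_div_pow hq0 hq1 ha hb hc hd he j (hz j hj)]
    -- The powers left over from the coefficient and from Bailey's sum cancel, as do `q^(j²)` and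
    -- its inverse; only `q ^ j`, the argument of the `₄φ₃`, remains.
    have hp : (f / e / (e * f / (a * b))) ^ j * (e ^ 2 / (a * b)) ^ j = 1 := by
      rw [← mul_pow, show f / e / (e * f / (a * b)) * (e ^ 2 / (a * b)) = 1 by field_simp, one_pow]
    have hY : q ^ j ^ 2 * (q ^ j ^ 2)⁻¹ = 1 := mul_inv_cancel₀ (pow_ne_zero _ hq0)
    generalize (f / e / (e * f / (a * b))) ^ j = p1 at *
    generalize (e ^ 2 / (a * b)) ^ j = p2 at *
    rw [div_eq_mul_inv _ (q ^ j ^ 2)]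
    generalize q ^ j ^ 2 = Y at *
    generalize Y⁻¹ = Y' at *
    simp only [div_eq_mul_inv _ (qPoch _ _ _), div_eq_mul_inv _ (qPoch _ _ _ * _), mul_inv]
    generalize (1 / b - 1 / a) * (qPochInf q q * qPochInf (q * a / b) q *
      qPochInf (q * b / a) q) * (qPochInf c q * qPochInf d q * qPochInf e q *
      qPochInf (c * d / (a * b)) q * qPochInf (c * e / (a * b)) q *
      qPochInf (d * e / (a * b)) q) / qPochInf (c * d * e / (q * a * b)) q = J
    generalize qPoch (q / (e * f / (a * b) * q ^ n)) q j = R1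
    generalize qPoch (1 / q ^ n) q j = R2
    generalize qPoch (q * (f / e)) q j = R3
    generalize qPoch (q * (f / e)) q n = R4
    generalize qPoch (e * f / (a * b)) q n = R5
    generalize qPoch q q j = R6
    generalize qPoch (q / e) q j = R7
    generalize qPoch (q * a * b / (c * e)) q j = R8
    generalize qPoch (q * a * b / (d * e)) q j = R9
    generalize qPoch (q ^ 2 * a * b / (c * d * e)) q j = R10
    linear_combination (J * R4 * R5 * R2 * R7 * R8 * R9 * R6⁻¹ * R1⁻¹ * R3⁻¹ * R10⁻¹ * q ^ j) *
      (p1 * p2 * hY + hp)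
  have hsum : rhoPrime q a b c d e f n - rhoPrime q b a c d e f n =
      rhoConst q a b c d e f n * ∑ j ∈ Finset.range (n + 1),
        shiftCoeff q (f / e) (e * f / (a * b)) n j *
          vwpDiff q a b c d (a * b) (e / q ^ j) := by
    simp only [rhoPrime, Hab.tsum_eq, Hba.tsum_eq, vwpDiff, mul_sub, Finset.sum_sub_distrib,
      Finset.mul_sum]
    congr 1 <;> exact Finset.sum_congr rfl fun j _ => by ring
  rw [hsum, Finset.sum_congr rfl key, ← Finset.mul_sum, basicHyp_four_three_terminating hq0]
  simp only [qPochList_cons, qPochList_nil, qPochInfList_cons, qPochInfList_nil, rhoConst,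
    mul_one]
  generalize (∑ j ∈ Finset.range (n + 1), _ : ℂ) = S
  simp only [div_eq_mul_inv, mul_inv]
  ring
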